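/- \textbf{Setting.} Let $M$ be a smooth $n$-dimensional manifold with a sub-Riemannian structure $(\mathcal D,g)$: $\mathcal D\subseteq TM$ is a smooth bracket-generating sub-bundle and $g$ a smooth scalar product on $\mathcal D$. Let $\pi:T^*M\to M$ be the projection, $\theta$ the Liouville one-form, $\sigma=d\theta$, and let $H(\lambda)=\frac12\sum_i\langle\lambda,X_i\rangle^2$ ($X_1,\dots,X_k$ a local orthonormal frame of $\mathcal D$) be the Hamiltonian, with Hamiltonian vector field $\vec H$ given by $\sigma(\cdot,\vec H)=dH$. An extremal with initial covector $\lambda$ is the integral curve $\lambda(t)=e^{t\vec H}(\lambda)$, on an open interval $J\ni 0$; its projection is the geodesic $\gamma(t)=\pi(\lambda(t))$. For a vector field $V(t)$ along $\lambda(t)$ set $\dot V(t)=\frac{d}{d\varepsilon}\big|_{\varepsilon=0}(e^{-\varepsilon\vec H})_*V(t+\varepsilon)$. For $c>0$ let $P_c:T^*M\to T^*M$, $P_c(\lambda)=c\lambda$, be the fiberwise dilation. \textbf{Young diagram.} For $i\ge1$ let $\mathcal F^i_{\gamma(t)}=\mathrm{span}\{\mathcal L_T^jX|_{\gamma(t)}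 : X\in\Gamma(\mathcal D),\ j\le i-1\}$, where $T\in\Gamma(\mathcal D)$ extends $\dot\gamma$ near time $t$ (the choice does not matter), and $\mathcal F^0=0$. The geodesic is equiregular if every $\dim\mathcal F^i_{\gamma(t)}$ is independent of $t$, and ample if for every $t$ some $\mathcal F^m_{\gamma(t)}$ is $T_{\gamma(t)}M$. Its Young diagram $D$ then has $i$-th column of length $\dim\mathcal F^i-\dim\mathcal F^{i-1}$. Its boxes are written $ai\in D$, with $a$ the row and $i=1,\dots,n_a$ the position in the row, $n_a$ being the length of row $a$. \textbf{Canonical frame.} Let $\lambda(t)$ be an extremal whose geodesic is ample and equiregular with Young diagram $D$. A smooth moving frame $\{E_{ai}(t),F_{ai}(t)\}_{ai\in D}$ of $T_{\lambda(t)}(T^*M)$ is \emph{canonical} with curvature matrix $R(t)=(R_{ai,bj}(t))$, a smooth family of matrices, if (i) $\pi_*E_{ai}=0$; (ii) $\sigma(E_{ai},E_{bj})=\sigma(F_{ai},F_{bj})=0$ and $\sigma(E_{ai},F_{bj})=\delta_{ab}\delta_{ij}$; (iii) $\dot E_{ai}=E_{a(i-1)}$ for $i\ge2$; $\dot E_{a1}=-F_{a1}$;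 $\dot F_{ai}=\sum_{bj}R_{ai,bj}(t)E_{bj}-F_{a(i+1)}$ for $i<n_a$; $\dot F_{an_a}=\sum_{bj}R_{an_a,bj}(t)E_{bj}$; and $R(t)$ is normal, that is: $R_{ai,bj}=R_{bj,ai}$; $R_{ai,b(i+1)}=-R_{bi,a(i+1)}$ if $n_a=n_b$ and $i<n_a$; if $n_a=n_b$ and $R_{ai,bj}\ne0$ then $|i-j|\le1$; and if $n_a>n_b$ and $R_{ai,bj}\neq0$ then $(i,j)$ is among the last $2n_b$ terms of the sequence of $n_a+n_b-1$ pairs $(1,1),(1,2),(2,2),(2,3),\dots,(n_b,n_b),(n_b+1,n_b),\dots,(n_a,n_b)$. \textbf{Proposition.} Let $\lambda\in T^*M$ with $H(\lambda)=\frac12$, let the geodesic of the extremal $\lambda(t)$ be ample and equiregular with Young diagram $D$, and let $\{E_{ai},F_{ai}\}_{ai\in D}$ be a canonical frame along $\lambda(t)$, $t\in J$, with curvature matrix $R^\lambda(t)$. Let $c>0$ and define, for $ct\in J$ and $ai\in D$, $$E^c_{ai}(t)=\frac1{c^i}\,(d_{\lambda(ct)}P_c)E_{ai}(ct),\qquad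 F^c_{ai}(t)=c^{i-1}(d_{\lambda(ct)}P_c)F_{ai}(ct).$$ Then $H(c\lambda)=\frac{c^2}2$; the extremal with initial covector $c\lambda$ is $\lambda^c(t)=c\,\lambda(ct)$, and its geodesic is ample and equiregular with the same Young diagram $D$; and $\{E^c_{ai},F^c_{ai}\}_{ai\in D}$ is a canonical frame along $\lambda^c(t)$, with curvature matrix $$R^{c\lambda}_{ai,bj}(t)=c^{i+j}R^\lambda_{ai,bj}(ct).$$ -/

import Mathlib

open Bundle Set Filter
open scoped Manifold ContDiff Topology

noncomputable section

namespace SubRiem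

/-! ### The cotangent bundle -/

/-- The model space `ℝⁿ`. -/
abbrev Model (n : ℕ) : Type := EuclideanSpace ℝ (Fin n)

/-- The model space `ℝⁿ × (ℝⁿ)*` of the cotangent bundle of an `n`-dimensional manifold. -/
abbrev CotModel (n : ℕ) : Type := Model n × (Model n →L[ℝ] ℝ)

/-- The model with corners (without boundary) of the cotangent bundle. -/
abbrev cotI (n : ℕ) : ModelWithCorners ℝ (CotModel n) (ModelProd (Model n) (Model n →L[ℝ] ℝ)) :=
  (𝓡 n).prod 𝓘(ℝ, Model n →L[ℝ] ℝ)

/-- The cotangent bundle `T*M`, the bundle of continuous linear functionals on the tangent spaces.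
A point `q` has a base point `q.proj` and a covector `q.snd : T_{q.proj} M →L[ℝ] ℝ`. -/
abbrev CotangentBundle (n : ℕ) (M : Type*) [TopologicalSpace M] [ChartedSpace (Model n) M] :=
  TotalSpace (Model n →L[ℝ] ℝ) (fun x : M => TangentSpace (𝓡 n) x →L[ℝ] ℝ)

section Cotangent

variable {n : ℕ} {M : Type*} [TopologicalSpace M] [ChartedSpace (Model n) M]

/-- Fiberwise dilation `P_c`, `λ ↦ c λ`. -/
def dilation (c : ℝ) (q : CotangentBundle n M) : CotangentBundle n M := ⟨q.proj, c • q.snd⟩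

variable [IsManifold (𝓡 n) ∞ M]

/-- The differential `π_*` at `q` of the projection `π : T*M → M`. -/
def dproj (q : CotangentBundle n M) :
    TangentSpace (cotI n) q →L[ℝ] TangentSpace (𝓡 n) q.proj :=
  mfderiv (cotI n) (𝓡 n) (fun p : CotangentBundle n M => p.proj) q

/-- The Liouville one-form `θ_q(ξ) = ⟨q, π_* ξ⟩`. -/
def liouville (q : CotangentBundle n M) : TangentSpace (cotI n) q →L[ℝ] ℝ :=
  q.snd.comp (dproj q)

/-- The expression, in the chart of `T*M` around `q`, of the Liouville one-form. -/
def liouvilleInChart (q : CotangentBundle n M) (z : CotModel n) : CotModel n →L[ℝ] ℝ :=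
  (liouville ((extChartAt (cotI n) q).symm z)).comp
    (mfderiv 𝓘(ℝ, CotModel n) (cotI n) (extChartAt (cotI n) q).symm z)

/-- The differential at `q` of the chart of `T*M` around `q`. -/
def dchart (q : CotangentBundle n M) : TangentSpace (cotI n) q →L[ℝ] CotModel n :=
  mfderiv (cotI n) 𝓘(ℝ, CotModel n) (extChartAt (cotI n) q) q

/-- The canonical symplectic form `σ = dθ` on `T*M`. The exterior derivative is computed in the
chart around the base point, where `dω(ξ, η) = (D_ξ ω)(η) - (D_η ω)(ξ)`. -/
def sympl (q : CotangentBundle n M) (ξ η : TangentSpace (cotI n) q) : ℝ :=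
  fderiv ℝ (liouvilleInChart q) (extChartAt (cotI n) q q) (dchart q ξ) (dchart q η) -
    fderiv ℝ (liouvilleInChart q) (extChartAt (cotI n) q q) (dchart q η) (dchart q ξ)

end Cotangent

/-! ### Sub-Riemannian structures -/

section Structures

variable {n : ℕ} {M : Type*} [TopologicalSpace M] [ChartedSpace (Model n) M]

/-- `X` is a smooth (global) vector field with values in the family of subspaces `D`, that is,
`X ∈ Γ(D)` when `D` is a sub-bundle of `TM`. -/
def IsSectionOf [IsManifold (𝓡 n) ∞ M] (D : ∀ x : M, Submodule ℝ (TangentSpace (𝓡 n) x))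
    (X : ∀ x : M, TangentSpace (𝓡 n) x) : Prop :=
  ContMDiff (𝓡 n) (𝓡 n).tangent ∞ (fun x => (⟨x, X x⟩ : TangentBundle (𝓡 n) M)) ∧
    ∀ x, X x ∈ D x

/-- The iterated Lie brackets of sections of `D`. -/
inductive IsIteratedBracket [IsManifold (𝓡 n) ∞ M]
    (D : ∀ x : M, Submodule ℝ (TangentSpace (𝓡 n) x)) : (∀ x : M, TangentSpace (𝓡 n) x) → Prop
  | of_section (X : ∀ x : M, TangentSpace (𝓡 n) x) (hX : IsSectionOf D X) :
      IsIteratedBracket D X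
  | bracket (X Y : ∀ x : M, TangentSpace (𝓡 n) x) (hX : IsIteratedBracket D X)
      (hY : IsIteratedBracket D Y) :
      IsIteratedBracket D (VectorField.mlieBracket (𝓡 n) X Y)

end Structures

/-- A sub-Riemannian structure `(D, g)` on the smooth `n`-dimensional manifold `M`: a smooth,
completely non-integrable (bracket-generating) vector sub-bundle `D` of `TM`, with a smooth scalar
product `g` on `D`. -/
structure SubRiemannianStructure (n : ℕ) (M : Type*) [TopologicalSpace M]
    [ChartedSpace (Model n) M] [IsManifold (𝓡 n) ∞ M] where
  /-- the rank of the distribution -/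
  rank : ℕ
  /-- the distribution -/
  D : ∀ x : M, Submodule ℝ (TangentSpace (𝓡 n) x)
  finrank_D : ∀ x, Module.finrank ℝ (D x) = rank
  /-- `D` has smooth local frames -/
  smooth_D : ∀ x : M, ∃ U : Set M, IsOpen U ∧ x ∈ U ∧
    ∃ X : Fin rank → ∀ y : M, TangentSpace (𝓡 n) y,
      (∀ i, ContMDiffOn (𝓡 n) (𝓡 n).tangent ∞
        (fun y => (⟨y, X i y⟩ : TangentBundle (𝓡 n) M)) U) ∧
      ∀ y ∈ U, Submodule.span ℝ (range fun i => X i y) = D y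
  /-- iterated brackets of sections of `D` span the tangent spaces -/
  bracketGenerating : ∀ x : M,
    Submodule.span ℝ {v | ∃ X, IsIteratedBracket D X ∧ X x = v} = ⊤
  /-- the scalar product on the distribution -/
  g : ∀ x : M, LinearMap.BilinForm ℝ (D x)
  g_symm : ∀ x v w, g x v w = g x w v
  g_pos : ∀ x v, v ≠ 0 → 0 < g x v v
  /-- `g(X, Y)` is a smooth function for all `X, Y ∈ Γ(D)` -/
  smooth_g : ∀ (X Y : ∀ x : M, TangentSpace (𝓡 n) x)
    (hX : IsSectionOf D X) (hY : IsSectionOf D Y),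
    ContMDiff (𝓡 n) 𝓘(ℝ, ℝ) ∞ (fun x => g x ⟨X x, hX.2 x⟩ ⟨Y x, hY.2 x⟩)

namespace SubRiemannianStructure

variable {n : ℕ} {M : Type*} [TopologicalSpace M] [ChartedSpace (Model n) M]
  [IsManifold (𝓡 n) ∞ M] (S : SubRiemannianStructure n M)

/-! ### The Hamiltonian, its extremals and its flow -/

theorem exists_orthonormal (x : M) :
    ∃ X : Fin S.rank → S.D x, ∀ i j, S.g x (X i) (X j) = if i = j then 1 else 0 := by
  have hf := S.finrank_D x
  let core : InnerProductSpace.Core ℝ (S.D x) :=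
    { inner := fun v w => S.g x v w
      conj_inner_symm := fun v w => by simpa using S.g_symm x w v
      re_inner_nonneg := fun v => by
        by_cases hv : v = 0
        · simp [hv]
        · simpa using (S.g_pos x v hv).le
      add_left := fun u v w => by simp
      smul_left := fun v w r => by simp
      definite := fun v hv => by
        by_contra h
        exact (S.g_pos x v h).ne' hv }
  let _ : NormedAddCommGroup (S.D x) := core.toNormedAddCommGroup
  let _ : InnerProductSpace ℝ (S.D x) := InnerProductSpace.ofCore core.toCore
  have : FiniteDimensional ℝ (TangentSpace (𝓡 n) x) :=
    inferInstanceAs (FiniteDimensional ℝ (Model n))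
  let b := (stdOrthonormalBasis ℝ (S.D x)).reindex (finCongr hf)
  exact ⟨fun i => b i, fun i j => orthonormal_iff_ite.mp b.orthonormal i j⟩

/-- An orthonormal basis of `(D_x, g_x)`. -/
def orthonormalBasisAt (x : M) : Fin S.rank → S.D x := (S.exists_orthonormal x).choose

/-- The sub-Riemannian Hamiltonian `H(λ) = ½ ∑ᵢ ⟨λ, Xᵢ⟩²`, where `X₁, …, X_k` is an orthonormal
basis of `D` at the base point of `λ` (the sum does not depend on the basis). -/
def hamiltonian (q : CotangentBundle n M) : ℝ :=
  (1 / 2) * ∑ i, (q.snd (S.orthonormalBasisAt q.proj i : TangentSpace (𝓡 n) q.proj)) ^ 2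

/-- The level set `{H = s / 2}`; the unit cotangent bundle is the case `s = 1`. -/
def levelSet (s : ℝ) : Set (CotangentBundle n M) := {q | S.hamiltonian q = s / 2}

/-- `v` is the value at `q` of the Hamiltonian vector field of `H`, the vector field that is
defined by `σ(·, H⃗) = dH`. -/
def IsHamiltonianVector (q : CotangentBundle n M) (v : TangentSpace (cotI n) q) : Prop :=
  ∀ ξ : TangentSpace (cotI n) q, sympl q ξ v = mfderiv (cotI n) 𝓘(ℝ, ℝ) S.hamiltonian q ξ

/-- `lam` is, on the open set `J` of times, an integral curve of the Hamiltonian vector field. -/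
def IsExtremalOn (lam : ℝ → CotangentBundle n M) (J : Set ℝ) : Prop :=
  ∀ t ∈ J, ∃ v : TangentSpace (cotI n) (lam t),
    HasMFDerivAt 𝓘(ℝ, ℝ) (cotI n) lam t ((1 : ℝ →L[ℝ] ℝ).smulRight v) ∧
      S.IsHamiltonianVector (lam t) v

/-- `Φ s q = e^{s H⃗}(q)` is the (smooth) local flow of the Hamiltonian vector field, for initial
points in the open set `U` and times `|s| < δ`. -/
structure IsLocalFlow (δ : ℝ) (U : Set (CotangentBundle n M))
    (Φ : ℝ → CotangentBundle n M → CotangentBundle n M) : Prop where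
  pos : 0 < δ
  isOpen : IsOpen U
  map_zero : ∀ q ∈ U, Φ 0 q = q
  integral : ∀ q ∈ U, S.IsExtremalOn (fun s => Φ s q) (Ioo (-δ) δ)
  smooth : ContMDiffOn (𝓘(ℝ, ℝ).prod (cotI n)) (cotI n) ∞
    (fun z : ℝ × CotangentBundle n M => Φ z.1 z.2) (Ioo (-δ) δ ×ˢ U)

/-- The vector field `V` along the extremal `lam` has, at time `t`, the Lie derivative
`V̇(t) = d/dε|_{ε=0} (e^{-εH⃗})_* V(t+ε)` equal to `W`. All the vectors `(e^{-εH⃗})_* V(t+ε)` are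
tangent to `T*M` at the same point `e^{-εH⃗}(lam (t+ε)) = lam t`, so the derivative is one of a
curve in a fixed vector space (the tangent space, which is identified with the model space by the
chart around that point). -/
def HasDot (lam : ℝ → CotangentBundle n M) (V : ∀ t : ℝ, TangentSpace (cotI n) (lam t)) (t : ℝ)
    (W : TangentSpace (cotI n) (lam t)) : Prop :=
  ∃ (δ : ℝ) (U : Set (CotangentBundle n M))
    (Φ : ℝ → CotangentBundle n M → CotangentBundle n M),
    S.IsLocalFlow δ U Φ ∧ lam t ∈ U ∧
    HasDerivAt (F := CotModel n)
      (fun ε : ℝ =>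
        (mfderiv (cotI n) (cotI n) (Φ (-ε)) (lam (t + ε)) (V (t + ε)) : CotModel n))
      W 0

/-! ### Geodesic flag, ample and equiregular geodesics -/

/-- The flag `F^i` at time `t` of the geodesic `γ`: the span of the vectors `L_T^j X` at `γ(t)`,
for `X ∈ Γ(D)`, `j ≤ i - 1`, where `T ∈ Γ(D)` extends the tangent vector field of `γ` near time
`t`. (The values do not depend on the extension. By convention `F^0 = 0`.) -/
def flag (γ : ℝ → M) (t : ℝ) (i : ℕ) : Submodule ℝ (TangentSpace (𝓡 n) (γ t)) :=
  Submodule.span ℝ {v | ∃ T X : ∀ x : M, TangentSpace (𝓡 n) x,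
    IsSectionOf S.D T ∧ IsSectionOf S.D X ∧
    (∀ᶠ s in 𝓝 t, T (γ s) = mfderiv 𝓘(ℝ, ℝ) (𝓡 n) γ s (1 : ℝ)) ∧
    ∃ j < i, v = ((fun Y => VectorField.mlieBracket (𝓡 n) T Y)^[j] X) (γ t)}

/-- The dimensions of the flag of `γ` do not depend on the time. -/
def IsEquiregular (γ : ℝ → M) (J : Set ℝ) : Prop :=
  ∀ i ≥ 1, ∀ s ∈ J, ∀ t ∈ J,
    Module.finrank ℝ (S.flag γ s i) = Module.finrank ℝ (S.flag γ t i)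

/-- At each time, the flag of `γ` reaches the whole tangent space. -/
def IsAmple (γ : ℝ → M) (J : Set ℝ) : Prop :=
  ∀ t ∈ J, ∃ m ≥ 1, Module.finrank ℝ (S.flag γ t m) = n

/-- The length of the `i`-th column of `y` is `dim F^i - dim F^{i-1}`, for all `i ≥ 1`. Columns in
Mathlib are counted from `0`. -/
def HasYoungDiagram (γ : ℝ → M) (J : Set ℝ) (y : YoungDiagram) : Prop :=
  ∀ t ∈ J, ∀ i : ℕ,
    Module.finrank ℝ (S.flag γ t (i + 1)) = Module.finrank ℝ (S.flag γ t i) + y.colLen i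

end SubRiemannianStructure

/-! ### Young diagrams and normal matrices -/

/-- The boxes of a Young diagram. -/
abbrev Box (y : YoungDiagram) : Type := {p : ℕ × ℕ // p ∈ y.cells}

namespace Box

variable {y : YoungDiagram}

/-- The row `a` of the box `ai` (only used as a label). -/
def row (p : Box y) : ℕ := p.1.1

/-- The position `i = 1, …, n_a` of the box `ai` in its row. -/
def col (p : Box y) : ℕ := p.1.2 + 1

/-- The length `n_a` of the row of the box `ai`. -/
def len (p : Box y) : ℕ := y.rowLen p.1.1

end Box

/-- The sequence of pairs `(i, j)` (for a given `n_b`) that starts from `(1,1)`, continues with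
`(1,2), (2,2), (2,3), …` up to `(n_b, n_b)` and then increases `i` only. The first `n_a + n_b - 1`
of its terms end with `(n_a, n_b)`. -/
def normalTable (nb : ℕ) : ℕ → ℕ × ℕ
  | 0 => (1, 1)
  | s + 1 =>
    let p := normalTable nb s
    if p.2 < nb ∧ p.1 = p.2 then (p.1, p.2 + 1) else (p.1 + 1, p.2)

/-- The normal condition for a matrix indexed by the boxes of a Young diagram. -/
structure IsNormal {y : YoungDiagram} (R : Matrix (Box y) (Box y) ℝ) : Prop where
  symm : ∀ p q, R p q = R q p
  /-- `R_{ai,b(i+1)} = - R_{bi,a(i+1)}` if `n_a = n_b` and `i < n_a`; here `p = ai`, `q = bi`,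
  `p' = a(i+1)`, `q' = b(i+1)` -/
  skew : ∀ p q p' q' : Box y, p.len = q.len → p.col = q.col →
    p'.row = p.row → q'.row = q.row → p'.col = p.col + 1 → q'.col = q.col + 1 →
    R p q' = - R q p'
  /-- the entries between rows of the same length -/
  vanish_eq : ∀ p q : Box y, p.len = q.len → R p q ≠ 0 → p.col ≤ q.col + 1 ∧ q.col ≤ p.col + 1
  /-- if `n_a > n_b`, an entry can be non-zero only at the last `2 n_b` among the `n_a + n_b - 1`
  pairs of the table (the case `n_a < n_b` follows by symmetry) -/
  vanish_gt : ∀ p q : Box y, q.len < p.len → R p q ≠ 0 →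
    ∃ s < p.len + q.len - 1, p.len + q.len - 1 ≤ s + 2 * q.len ∧
      (p.col, q.col) = normalTable q.len s

/-! ### Canonical frames -/

/-- `{E_{ai}, F_{ai}}` is a canonical frame, with curvature matrix `R`, along the extremal
`lam`, defined on the open interval `J ∋ 0`, with initial covector `q₀`, where `y` is the Young
diagram of the corresponding (ample and equiregular) geodesic. -/
structure IsCanonicalFrame {n : ℕ} {M : Type*} [TopologicalSpace M] [ChartedSpace (Model n) M]
    [IsManifold (𝓡 n) ∞ M] (S : SubRiemannianStructure n M) (q₀ : CotangentBundle n M)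
    (J : Set ℝ) (lam : ℝ → CotangentBundle n M) (y : YoungDiagram)
    (E F : Box y → ∀ t : ℝ, TangentSpace (cotI n) (lam t))
    (R : ℝ → Matrix (Box y) (Box y) ℝ) : Prop where
  isOpen : IsOpen J
  ordConnected : J.OrdConnected
  zero_mem : (0 : ℝ) ∈ J
  initial : lam 0 = q₀
  extremal : S.IsExtremalOn lam J
  ample : S.IsAmple (fun t => (lam t).proj) J
  equiregular : S.IsEquiregular (fun t => (lam t).proj) J
  young : S.HasYoungDiagram (fun t => (lam t).proj) J y
  /-- a smooth moving frame along the extremal -/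
  smooth_E : ∀ p, ContMDiffOn 𝓘(ℝ, ℝ) (cotI n).tangent ∞
    (fun t => (⟨lam t, E p t⟩ : TangentBundle (cotI n) (CotangentBundle n M))) J
  smooth_F : ∀ p, ContMDiffOn 𝓘(ℝ, ℝ) (cotI n).tangent ∞
    (fun t => (⟨lam t, F p t⟩ : TangentBundle (cotI n) (CotangentBundle n M))) J
  linearIndependent : ∀ t ∈ J,
    LinearIndependent ℝ (Sum.elim (fun p => E p t) (fun p => F p t))
  span_eq_top : ∀ t ∈ J,
    Submodule.span ℝ (range (Sum.elim (fun p => E p t) (fun p => F p t))) = ⊤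
  /-- (i) the `E`'s are vertical -/
  vertical : ∀ p, ∀ t ∈ J, dproj (lam t) (E p t) = 0
  /-- (ii) the frame is Darboux -/
  darboux_EE : ∀ p q, ∀ t ∈ J, sympl (lam t) (E p t) (E q t) = 0
  darboux_FF : ∀ p q, ∀ t ∈ J, sympl (lam t) (F p t) (F q t) = 0
  darboux_EF : ∀ p q, ∀ t ∈ J, sympl (lam t) (E p t) (F q t) = if p = q then 1 else 0
  /-- (iii) structural equations: `Ė_{ai} = E_{a(i-1)}` for `i ≥ 2` (`p = ai`, `p' = a(i-1)`) -/
  dot_E : ∀ p p' : Box y, p'.row = p.row → p.col = p'.col + 1 → ∀ t ∈ J,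
    S.HasDot lam (E p) t (E p' t)
  /-- `Ė_{a1} = - F_{a1}` -/
  dot_E_one : ∀ p : Box y, p.col = 1 → ∀ t ∈ J, S.HasDot lam (E p) t (-(F p t))
  /-- `Ḟ_{ai} = ∑ R_{ai,bj} E_{bj} - F_{a(i+1)}` for `i < n_a` (`p = ai`, `p' = a(i+1)`) -/
  dot_F : ∀ p p' : Box y, p'.row = p.row → p'.col = p.col + 1 → ∀ t ∈ J,
    S.HasDot lam (F p) t ((∑ q, R t p q • E q t) - F p' t)
  /-- `Ḟ_{a n_a} = ∑ R_{a n_a,bj} E_{bj}` -/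
  dot_F_last : ∀ p : Box y, p.col = p.len → ∀ t ∈ J,
    S.HasDot lam (F p) t (∑ q, R t p q • E q t)
  /-- the curvature matrix is smooth in time and normal (in particular symmetric) -/
  smooth_R : ∀ p q, ContDiffOn ℝ ∞ (fun t => R t p q) J
  normal : ∀ t ∈ J, IsNormal (R t)

end SubRiem

end

noncomputable section

namespace SubRiem

/-! Everything follows from two homogeneities of the dilation `P_c`. Since `π ∘ P_c = π`, the
Liouville form satisfies `P_c^* θ = c θ`, hence `P_c^* σ = c σ` (`sympl_dilation`). Since `H` is
quadratic on fibers, `H ∘ P_c = c² H`. Comparing the two in `σ(·, H⃗) = dH` gives `H⃗(c λ) = dP_c (c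
H⃗(λ))`. So `c λ(c t)` is an extremal, and the flow is conjugated: `e^{s H⃗} = P_c ∘ e^{c s H⃗} ∘
P_c⁻¹`.

Conjugation turns the dot derivative into a rule with one extra factor (`HasDot.dilate`): if `V̇ =
W` at time `c t`, then `a dP_c V(c ·)` has derivative `a c dP_c W` at `t`. The weights `c^{-i}` of
`E_{ai}` and `c^{i-1}` of `F_{ai}` are adapted to this factor. Multiplication by `c` sends the
weight of `E_{ai}` to that of `E_{a(i-1)}`, that of `E_{a1}` to that of `F_{a1}`, and that of
`F_{ai}` to that of `F_{a(i+1)}`. The frame stays Darboux because `c^{-i} c^{i-1} c = 1`. In the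
equation for `F_{ai}` the total factor `c^i` must be written against vectors of weight `c^{-j}`,
which yields `c^{i+j}` in the curvature; normality survives because this factor depends on `i + j`
only.

The projected geodesic is merely reparametrized, `γ(c t)`. An extension `T` of its velocity becomes
`c T`, so the generators of the flag are multiplied by non-zero powers of `c` and the flag at `t` is
the old one at `c t` (`flag_comp_mul`). The Young diagram, ampleness and equiregularity carry over.
-/

/-- The expression `(x, p) ↦ (x, c p)` of the dilation in the charts of the cotangent bundle. -/
def modelDilation (n : ℕ) (c : ℝ) : CotModel n →L[ℝ] CotModel n :=
  (ContinuousLinearMap.id ℝ (Model n)).prodMap (c • ContinuousLinearMap.id ℝ (Model n →L[ℝ] ℝ))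

theorem modelDilation_apply {n : ℕ} (c : ℝ) (z : CotModel n) :
    modelDilation n c z = (z.1, c • z.2) := rfl

/-- `modelDilation` for a non-zero factor, as an equivalence. -/
def modelDilationEquiv (n : ℕ) {c : ℝ} (hc : c ≠ 0) : CotModel n ≃L[ℝ] CotModel n :=
  ContinuousLinearEquiv.equivOfInverse (modelDilation n c) (modelDilation n c⁻¹)
    (fun z => by ext <;> simp [modelDilation_apply, hc])
    (fun z => by ext <;> simp [modelDilation_apply, hc])

/-- The relation `L^* α = c α` is differentiated directly: `L` is linear, so no second-order term
appears and the full derivative scales, even before antisymmetrization. No differentiability of `α`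
is needed, since `fderiv` commutes with composition by continuous linear equivalences and with
scalars of a field. -/
theorem fderiv_oneForm_comp_equiv {V : Type*} [NormedAddCommGroup V] [NormedSpace ℝ V]
    (L : V ≃L[ℝ] V) (c : ℝ) (α : V → V →L[ℝ] ℝ) (z : V)
    (h : ∀ᶠ w in 𝓝 z, ∀ v, α (L w) (L v) = c * α w v) (ξ η : V) :
    fderiv ℝ α (L z) (L ξ) (L η) = c * fderiv ℝ α z ξ η := by
  -- `T` is the pullback `φ ↦ φ ∘ L` on covectors.
  let T : (V →L[ℝ] ℝ) ≃L[ℝ] (V →L[ℝ] ℝ) :=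
    L.symm.arrowCongr (ContinuousLinearEquiv.refl ℝ ℝ)
  have hT : T ∘ (α ∘ L) =ᶠ[𝓝 z] c • α := by
    filter_upwards [h] with w hw
    exact ContinuousLinearMap.ext hw
  have h2 := hT.fderiv_eq (𝕜 := ℝ)
  rw [T.comp_fderiv, L.comp_right_fderiv, fderiv_const_smul_field (R := ℝ) (f := α) c] at h2
  exact congrArg (fun A : V →L[ℝ] V →L[ℝ] ℝ => A ξ η) h2

theorem bilin_sub_swap_smul_right {V : Type*} [NormedAddCommGroup V] [NormedSpace ℝ V]
    (B : V →L[ℝ] V →L[ℝ] ℝ) (a : ℝ) (ξ η : V) :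
    B ξ (a • η) - B (a • η) ξ = a * (B ξ η - B η ξ) := by
  simp [mul_sub]

/-! ### The dilation in the charts of the cotangent bundle -/

variable {n : ℕ} {M : Type*} [TopologicalSpace M] [ChartedSpace (Model n) M]

theorem dilation_inv_dilation {c : ℝ} (hc : c ≠ 0) (q : CotangentBundle n M) :
    dilation c⁻¹ (dilation c q) = q :=
  congrArg (TotalSpace.mk q.proj) (inv_smul_smul₀ hc q.snd)

theorem dilation_dilation_inv {c : ℝ} (hc : c ≠ 0) (q : CotangentBundle n M) :
    dilation c (dilation c⁻¹ q) = q :=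
  congrArg (TotalSpace.mk q.proj) (smul_inv_smul₀ hc q.snd)

variable [IsManifold (𝓡 n) ∞ M]

/-- The preferred chart of the total space at a point depends on its base point only, and dilation
fixes base points. -/
theorem extChartAt_dilation (c : ℝ) (q : CotangentBundle n M) :
    extChartAt (cotI n) (dilation c q) = extChartAt (cotI n) q := rfl

/-- Chart domains are full preimages under `π` of base chart domains; this makes them stable under
dilation. -/
theorem mem_extChartAt_source_iff (q r : CotangentBundle n M) :
    r ∈ (extChartAt (cotI n) q).source ↔ r.proj ∈ (extChartAt (𝓡 n) q.proj).source := by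
  have h1 : r ∈ (extChartAt (cotI n) q).source ↔ r ∈ (chartAt
      (ModelProd (Model n) (Model n →L[ℝ] ℝ)) q).source := by
    rw [extChartAt_source]
  rw [h1, FiberBundle.chartedSpace_chartAt, extChartAt_source]
  rw [OpenPartialHomeomorph.trans_source]
  have h2 : ∀ x y : M, y ∈ (trivializationAt (Model n →L[ℝ] ℝ)
      (fun x : M => TangentSpace (𝓡 n) x →L[ℝ] ℝ) x).baseSet ↔
        y ∈ (chartAt (Model n) x).source := fun x y => by simp
  constructor
  · rintro ⟨hr, -⟩
    exact (h2 _ _).1 (((trivializationAt (Model n →L[ℝ] ℝ)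
      (fun x : M => TangentSpace (𝓡 n) x →L[ℝ] ℝ) q.proj).mem_source).1 hr)
  · intro hr
    have hb := (h2 _ _).2 hr
    refine ⟨((trivializationAt (Model n →L[ℝ] ℝ)
      (fun x : M => TangentSpace (𝓡 n) x →L[ℝ] ℝ) q.proj).mem_source).2 hb, ?_, mem_univ _⟩
    change (trivializationAt (Model n →L[ℝ] ℝ)
      (fun x : M => TangentSpace (𝓡 n) x →L[ℝ] ℝ) q.proj r).1 ∈ _
    rw [Trivialization.coe_fst' _ hb]
    exact hr

theorem extChartAt_dilation_apply (c : ℝ) (q r : CotangentBundle n M)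
    (hr : r ∈ (extChartAt (cotI n) q).source) :
    extChartAt (cotI n) q (dilation c r) = modelDilation n c (extChartAt (cotI n) q r) := by
  rw [mem_extChartAt_source_iff] at hr
  rw [FiberBundle.extChartAt]
  have hb : r.proj ∈ (trivializationAt (Model n →L[ℝ] ℝ)
      (fun x : M => TangentSpace (𝓡 n) x →L[ℝ] ℝ) q.proj).baseSet := by
    simpa using hr
  have h := ((trivializationAt (Model n →L[ℝ] ℝ)
      (fun x : M => TangentSpace (𝓡 n) x →L[ℝ] ℝ) q.proj).linear ℝ hb).map_smul c r.snd
  ext1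
  · change extChartAt (𝓡 n) q.proj (trivializationAt (Model n →L[ℝ] ℝ)
      (fun x : M => TangentSpace (𝓡 n) x →L[ℝ] ℝ) q.proj (dilation c r)).1 =
      extChartAt (𝓡 n) q.proj (trivializationAt (Model n →L[ℝ] ℝ)
      (fun x : M => TangentSpace (𝓡 n) x →L[ℝ] ℝ) q.proj r).1
    rw [Trivialization.coe_fst' _ hb,
      Trivialization.coe_fst' _ (show (dilation c r).proj ∈ _ from hb)]
    rfl
  · exact h

theorem contMDiff_dilation (c : ℝ) :
    ContMDiff (cotI n) (cotI n) ∞ (dilation c : CotangentBundle n M → CotangentBundle n M) := by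
  intro q
  have hid := Bundle.contMDiffAt_totalSpace.1 (contMDiffAt_id (I := cotI n) (n := ∞) (x := q))
  rw [Bundle.contMDiffAt_totalSpace]
  refine ⟨hid.1, ?_⟩
  have h2 : ContMDiffAt (cotI n) 𝓘(ℝ, Model n →L[ℝ] ℝ) ∞ (fun r : CotangentBundle n M =>
    c • (trivializationAt (Model n →L[ℝ] ℝ)
      (fun x : M => TangentSpace (𝓡 n) x →L[ℝ] ℝ) q.proj r).2) q :=
    (contMDiffAt_const (I' := 𝓘(ℝ, ℝ)) (c := c)).smul hid.2
  refine h2.congr_of_eventuallyEq ?_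
  have hs : (extChartAt (cotI n) q).source ∈ 𝓝 q := extChartAt_source_mem_nhds q
  filter_upwards [hs] with r hr
  have hb : r.proj ∈ (trivializationAt (Model n →L[ℝ] ℝ)
      (fun x : M => TangentSpace (𝓡 n) x →L[ℝ] ℝ) q.proj).baseSet := by
    rw [mem_extChartAt_source_iff] at hr
    simpa using hr
  exact ((trivializationAt (Model n →L[ℝ] ℝ)
      (fun x : M => TangentSpace (𝓡 n) x →L[ℝ] ℝ) q.proj).linear ℝ hb).map_smul c r.snd

theorem dilation_mem_source (c : ℝ) (q r : CotangentBundle n M)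
    (hr : r ∈ (extChartAt (cotI n) q).source) :
    dilation c r ∈ (extChartAt (cotI n) q).source := by
  rw [mem_extChartAt_source_iff] at hr ⊢
  exact hr

theorem extChartAt_symm_modelDilation (c : ℝ) (q : CotangentBundle n M) (z : CotModel n)
    (hz : z ∈ (extChartAt (cotI n) q).target) :
    (extChartAt (cotI n) q).symm (modelDilation n c z) =
      dilation c ((extChartAt (cotI n) q).symm z) := by
  have hs := (extChartAt (cotI n) q).map_target hz
  have h := extChartAt_dilation_apply c q _ hs
  rw [(extChartAt (cotI n) q).right_inv hz] at h
  rw [← h, (extChartAt (cotI n) q).left_inv (dilation_mem_source c q _ hs)]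

theorem modelDilation_mem_target (c : ℝ) (q : CotangentBundle n M) (z : CotModel n)
    (hz : z ∈ (extChartAt (cotI n) q).target) :
    modelDilation n c z ∈ (extChartAt (cotI n) q).target := by
  have hs := (extChartAt (cotI n) q).map_target hz
  have h := extChartAt_dilation_apply c q _ hs
  rw [(extChartAt (cotI n) q).right_inv hz] at h
  rw [← h]
  exact (extChartAt (cotI n) q).map_source (dilation_mem_source c q _ hs)

/-- The preferred charts at `q` and at `c q` coincide, and in them the dilation is the linear map
`modelDilation`, which is its own derivative. -/
theorem hasMFDerivAt_dilation (c : ℝ) (q : CotangentBundle n M) :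
    HasMFDerivAt (cotI n) (cotI n) (dilation c) q (modelDilation n c) := by
  refine ⟨(contMDiff_dilation c).continuous.continuousAt, ?_⟩
  refine (modelDilation n c).hasFDerivAt.hasFDerivWithinAt.congr_of_eventuallyEq ?_ ?_
  · filter_upwards [mem_nhdsWithin_of_mem_nhds (extChartAt_target_mem_nhds (I := cotI n) q)]
      with z hz
    rw [writtenInExtChartAt, extChartAt_dilation, Function.comp_apply, Function.comp_apply,
      extChartAt_dilation_apply c q _ ((extChartAt (cotI n) q).map_target hz),
      (extChartAt (cotI n) q).right_inv hz]
  · rw [writtenInExtChartAt, extChartAt_dilation, Function.comp_apply, Function.comp_apply,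
      extChartAt_to_inv, extChartAt_dilation_apply c q _ (mem_extChartAt_source q)]

theorem mfderiv_dilation (c : ℝ) (q : CotangentBundle n M) :
    mfderiv (cotI n) (cotI n) (dilation c) q = modelDilation n c :=
  (hasMFDerivAt_dilation c q).mfderiv

/-! ### The Liouville and symplectic forms under dilation -/

theorem dproj_dilation (c : ℝ) (q : CotangentBundle n M) (ξ : CotModel n) :
    (dproj (dilation c q) (modelDilation n c ξ) : Model n) = dproj q ξ := by
  have hp : ∀ r : CotangentBundle n M, MDifferentiableAt (cotI n) (𝓡 n)
      (fun p : CotangentBundle n M => p.proj) r := fun r =>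
    ((Bundle.contMDiff_proj (n := ∞) (fun x : M => TangentSpace (𝓡 n) x →L[ℝ] ℝ))
      r).mdifferentiableAt (by simp)
  have h := (hp (dilation c q)).hasMFDerivAt.comp q (hasMFDerivAt_dilation c q)
  have h2 := h.mfderiv
  exact (DFunLike.congr_fun h2 ξ).symm

theorem liouville_dilation (c : ℝ) (q : CotangentBundle n M) (ξ : CotModel n) :
    liouville (dilation c q) (modelDilation n c ξ) = c * liouville q ξ := by
  have h := dproj_dilation c q ξ
  change (c • q.snd) (dproj (dilation c q) (modelDilation n c ξ)) = c * q.snd (dproj q ξ)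
  exact congrArg (fun v => (c • q.snd) v) h

/-- Tangent vectors at `q` are coordinatized by the preferred chart at `q`, whose differential there
is therefore the identity. -/
theorem dchart_eq_id (q : CotangentBundle n M) (ξ : CotModel n) : dchart q ξ = ξ := by
  have h : HasMFDerivAt (cotI n) 𝓘(ℝ, CotModel n) (extChartAt (cotI n) q) q
      (ContinuousLinearMap.id ℝ (CotModel n)) := by
    refine ⟨continuousAt_extChartAt q, ?_⟩
    refine (hasFDerivAt_id _).hasFDerivWithinAt.congr_of_eventuallyEq ?_ ?_
    · filter_upwards [mem_nhdsWithin_of_mem_nhds (extChartAt_target_mem_nhds (I := cotI n) q)]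
        with z hz
      exact (extChartAt (cotI n) q).right_inv hz
    · exact congrArg (extChartAt (cotI n) q) (extChartAt_to_inv q)
  exact DFunLike.congr_fun h.mfderiv ξ

/-- The relation `P_c^* θ = c θ` read in a fixed chart. It is required on the whole chart target,
because it will be differentiated. -/
theorem liouvilleInChart_modelDilation (c : ℝ) (q : CotangentBundle n M) (z v : CotModel n)
    (hz : z ∈ (extChartAt (cotI n) q).target) :
    liouvilleInChart q (modelDilation n c z) (modelDilation n c v) =
      c * liouvilleInChart q z v := by
  -- Transports along equality of base points, with tangent vectors viewed in the common model
  -- space.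
  have key : ∀ r r' : CotangentBundle n M, r = r' → ∀ w : CotModel n,
      (liouville r w : ℝ) = liouville r' w := by
    rintro r r' rfl w; rfl
  have hd : ∀ w ∈ (extChartAt (cotI n) q).target, MDifferentiableAt 𝓘(ℝ, CotModel n) (cotI n)
      (extChartAt (cotI n) q).symm w := fun w hw =>
    (((contMDiffOn_extChartAt_symm (n := ∞) q) w hw).contMDiffAt
      ((isOpen_extChartAt_target q).mem_nhds hw)).mdifferentiableAt (by simp)
  have h1 := (hasMFDerivAt_dilation c _).comp z (hd z hz).hasMFDerivAt
  have h2 := (hd _ (modelDilation_mem_target c q z hz)).hasMFDerivAt.comp z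
    (modelDilation n c).hasMFDerivAt
  have h3 : (extChartAt (cotI n) q).symm ∘ modelDilation n c =ᶠ[𝓝 z]
      dilation c ∘ (extChartAt (cotI n) q).symm := by
    filter_upwards [(isOpen_extChartAt_target q).mem_nhds hz] with w hw
    exact extChartAt_symm_modelDilation c q w hw
  have h4 : (mfderiv 𝓘(ℝ, CotModel n) (cotI n) (extChartAt (cotI n) q).symm
      (modelDilation n c z) (modelDilation n c v) : CotModel n) =
      modelDilation n c (mfderiv 𝓘(ℝ, CotModel n) (cotI n) (extChartAt (cotI n) q).symm z v) :=
    DFunLike.congr_fun (h2.mfderiv.symm.trans ((h3.mfderiv_eq).trans h1.mfderiv)) v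
  change (liouville _ (mfderiv 𝓘(ℝ, CotModel n) (cotI n) (extChartAt (cotI n) q).symm
      (modelDilation n c z) (modelDilation n c v) : CotModel n) : ℝ) = _
  refine (key _ _ (extChartAt_symm_modelDilation c q z hz) _).trans ?_
  refine (congrArg (fun w : CotModel n => (liouville (dilation c
    ((extChartAt (cotI n) q).symm z)) w : ℝ)) h4).trans ?_
  exact liouville_dilation c _ _

theorem fderiv_liouvilleInChart_modelDilation {c : ℝ} (hc : c ≠ 0) (q : CotangentBundle n M)
    (z ξ η : CotModel n) (hz : z ∈ (extChartAt (cotI n) q).target) :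
    fderiv ℝ (liouvilleInChart q) (modelDilation n c z) (modelDilation n c ξ)
      (modelDilation n c η) = c * fderiv ℝ (liouvilleInChart q) z ξ η := by
  refine fderiv_oneForm_comp_equiv (modelDilationEquiv n hc) c (liouvilleInChart q) z ?_ ξ η
  filter_upwards [(isOpen_extChartAt_target q).mem_nhds hz] with w hw v
  exact liouvilleInChart_modelDilation c q w v hw

theorem sympl_smul_right (a : ℝ) (q : CotangentBundle n M) (ξ η : TangentSpace (cotI n) q) :
    sympl q ξ (a • η) = a * sympl q ξ η := by
  unfold sympl
  rw [ContinuousLinearMap.map_smul]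
  exact bilin_sub_swap_smul_right _ a _ _

theorem sympl_swap (q : CotangentBundle n M) (ξ η : TangentSpace (cotI n) q) :
    sympl q ξ η = -sympl q η ξ :=
  (neg_sub _ _).symm

theorem sympl_smul_left (a : ℝ) (q : CotangentBundle n M) (ξ η : TangentSpace (cotI n) q) :
    sympl q (a • ξ) η = a * sympl q ξ η := by
  rw [sympl_swap, sympl_smul_right, sympl_swap q ξ η, mul_neg]

theorem sympl_dilation {c : ℝ} (hc : c ≠ 0) (q : CotangentBundle n M) (ξ η : CotModel n) :
    sympl (dilation c q) (modelDilation n c ξ) (modelDilation n c η) = c * sympl q ξ η := by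
  have hz : extChartAt (cotI n) (dilation c q) (dilation c q) =
      modelDilation n c (extChartAt (cotI n) q q) :=
    extChartAt_dilation_apply c q q (mem_extChartAt_source q)
  have hl : liouvilleInChart (dilation c q) = liouvilleInChart q := rfl
  unfold sympl
  rw [hz, hl]
  simp only [dchart_eq_id]
  have h := fderiv_liouvilleInChart_modelDilation hc q _ ξ η (mem_extChartAt_target q)
  have h' := fderiv_liouvilleInChart_modelDilation hc q _ η ξ (mem_extChartAt_target q)
  rw [h, h', mul_sub]

/-! ### The Hamiltonian, its extremals, its flow and the dot derivative under dilation -/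

namespace SubRiemannianStructure

variable {n : ℕ} {M : Type*} [TopologicalSpace M] [ChartedSpace (Model n) M]
  [IsManifold (𝓡 n) ∞ M] (S : SubRiemannianStructure n M)

theorem hamiltonian_dilation (c : ℝ) (q : CotangentBundle n M) :
    S.hamiltonian (dilation c q) = c ^ 2 * S.hamiltonian q := by
  have h : ∀ i, (dilation c q).snd (S.orthonormalBasisAt (dilation c q).proj i :
      TangentSpace (𝓡 n) (dilation c q).proj) = c * q.snd (S.orthonormalBasisAt q.proj i) :=
    fun i => rfl
  unfold hamiltonian
  simp only [h, mul_pow]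
  rw [← Finset.mul_sum]
  ring

/-- The differential of the Hamiltonian, in the coordinates of the model space. -/
def dHamiltonian (q : CotangentBundle n M) : CotModel n →L[ℝ] ℝ :=
  mfderiv (cotI n) 𝓘(ℝ, ℝ) S.hamiltonian q

/-- The chain rule for `H ∘ P_c = c² H`. Smoothness of `H` is not assumed: as `P_c` is invertible,
`H` is differentiable at both `q` and `c q` or at neither, and in the latter case both derivatives
take the default value `0`. -/
theorem dHamiltonian_dilation {c : ℝ} (hc : c ≠ 0) (q : CotangentBundle n M)
    (ξ : CotModel n) :
    S.dHamiltonian (dilation c q) (modelDilation n c ξ) = c ^ 2 * S.dHamiltonian q ξ := by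
  have hcomp : c ^ 2 • S.hamiltonian = S.hamiltonian ∘ dilation c :=
    funext fun q => (S.hamiltonian_dilation c q).symm
  by_cases h : MDifferentiableAt (cotI n) 𝓘(ℝ, ℝ) S.hamiltonian (dilation c q)
  · have h1 := h.hasMFDerivAt.comp q (hasMFDerivAt_dilation c q)
    have h2 : MDifferentiableAt (cotI n) 𝓘(ℝ, ℝ) S.hamiltonian q := by
      have h3 := (h1.const_smul (c ^ 2)⁻¹).mdifferentiableAt
      rwa [← hcomp, inv_smul_smul₀ (pow_ne_zero 2 hc)] at h3
    have h4 := (h2.hasMFDerivAt.const_smul (c ^ 2)).congr_of_eventuallyEq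
      (Eventually.of_forall fun r => (congrFun hcomp r).symm)
    exact congrArg (fun A : CotModel n →L[ℝ] ℝ => A ξ) (hasMFDerivAt_unique h1 h4)
  · have h' : ¬ MDifferentiableAt (cotI n) 𝓘(ℝ, ℝ) S.hamiltonian q := by
      intro h0
      apply h
      have hd := (hasMFDerivAt_dilation c⁻¹ (dilation c q)).mdifferentiableAt
      have h0' : MDifferentiableAt (cotI n) 𝓘(ℝ, ℝ) S.hamiltonian
          (dilation c⁻¹ (dilation c q)) := by rwa [dilation_inv_dilation hc]
      have h5 := (h0'.comp (dilation c q) hd).const_smul (c ^ 2)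
      refine h5.congr_of_eventuallyEq (Eventually.of_forall fun r => ?_)
      change S.hamiltonian r = c ^ 2 * S.hamiltonian (dilation c⁻¹ r)
      rw [hamiltonian_dilation]; field_simp
    unfold dHamiltonian
    rw [mfderiv_zero_of_not_mdifferentiableAt h, mfderiv_zero_of_not_mdifferentiableAt h']
    exact (mul_zero _).symm

/-- One factor `c` comes from `P_c^* σ = c σ` and one from `c • v`; together they match the `c²` of
`dH`. Testing on vectors `dP_c ξ` suffices, as `dP_c` is onto. -/
theorem IsHamiltonianVector.dilate {S : SubRiemannianStructure n M} {c : ℝ} (hc : c ≠ 0)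
    {q : CotangentBundle n M} {v : CotModel n} (hv : S.IsHamiltonianVector q v) :
    S.IsHamiltonianVector (dilation c q) (modelDilation n c (c • v) : CotModel n) := by
  intro ξ
  obtain ⟨ξ, rfl⟩ := (modelDilationEquiv n hc).surjective ξ
  refine (sympl_dilation hc q ξ (c • v)).trans ?_
  refine (congrArg (c * ·) (sympl_smul_right c q ξ v)).trans ?_
  refine Eq.trans ?_ (S.dHamiltonian_dilation hc q ξ).symm
  rw [hv ξ, sq, mul_assoc]
  rfl

theorem IsExtremalOn.dilate {S : SubRiemannianStructure n M} {c : ℝ} (hc : c ≠ 0)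
    {lam : ℝ → CotangentBundle n M} {J : Set ℝ} (h : S.IsExtremalOn lam J) :
    S.IsExtremalOn (fun t => dilation c (lam (c * t))) {t | c * t ∈ J} := by
  intro t ht
  obtain ⟨v, hd, hv⟩ := h (c * t) ht
  refine ⟨(modelDilation n c (c • v) : CotModel n), ?_, hv.dilate hc⟩
  have hm : HasMFDerivAt 𝓘(ℝ, ℝ) 𝓘(ℝ, ℝ) (fun t : ℝ => c * t) t
      (c • ContinuousLinearMap.id ℝ ℝ) :=
    ((hasFDerivAt_id (𝕜 := ℝ) t).const_smul c :
      HasFDerivAt (fun t : ℝ => c * t) _ t).hasMFDerivAt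
  have h1 := (hasMFDerivAt_dilation c (lam (c * t))).comp t (hd.comp t hm)
  have h2 : ∀ v : CotModel n, (modelDilation n c).comp
      (((1 : ℝ →L[ℝ] ℝ).smulRight v).comp (c • ContinuousLinearMap.id ℝ ℝ)) =
      (1 : ℝ →L[ℝ] ℝ).smulRight (modelDilation n c (c • v)) := by
    intro v
    refine ContinuousLinearMap.ext fun s => ?_
    change modelDilation n c ((c • s) • v) = s • modelDilation n c (c • v)
    refine Eq.trans ?_ ((modelDilation n c).map_smul s (c • v))
    rw [smul_smul, smul_eq_mul, mul_comm]
  exact h1.congr_mfderiv (h2 v)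

/-- The flow conjugated by `P_c` and run at speed `c`; the time bound becomes `δ / c` so that `c s`
stays within `(-δ, δ)`. -/
theorem IsLocalFlow.dilate {S : SubRiemannianStructure n M} {c : ℝ} (hc : 0 < c) {δ : ℝ}
    {U : Set (CotangentBundle n M)} {Φ : ℝ → CotangentBundle n M → CotangentBundle n M}
    (h : S.IsLocalFlow δ U Φ) :
    S.IsLocalFlow (δ / c) (dilation c⁻¹ ⁻¹' U)
      (fun s q => dilation c (Φ (c * s) (dilation c⁻¹ q))) := by
  have hmaps : ∀ s ∈ Ioo (-(δ / c)) (δ / c), c * s ∈ Ioo (-δ) δ := by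
    rintro s ⟨h1, h2⟩
    rw [lt_div_iff₀ hc] at h2
    rw [← neg_div, div_lt_iff₀ hc] at h1
    constructor <;> linarith
  refine ⟨div_pos h.pos hc, h.isOpen.preimage (contMDiff_dilation _).continuous, ?_, ?_, ?_⟩
  · intro q hq
    simp only [mul_zero]
    rw [h.map_zero _ hq, dilation_dilation_inv hc.ne']
  · intro q hq t ht
    exact (h.integral _ hq).dilate hc.ne' t (hmaps t ht)
  · refine (contMDiff_dilation c).comp_contMDiffOn ?_
    have h1 : ContMDiff (𝓘(ℝ, ℝ).prod (cotI n)) (𝓘(ℝ, ℝ).prod (cotI n)) ∞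
        (fun z : ℝ × CotangentBundle n M => (c * z.1, dilation c⁻¹ z.2)) := by
      refine ContMDiff.prodMk ?_ ((contMDiff_dilation c⁻¹).comp contMDiff_snd)
      exact (contDiff_const.mul contDiff_id).contMDiff.comp contMDiff_fst
    exact h.smooth.comp h1.contMDiffOn (fun z hz => ⟨hmaps _ hz.1, hz.2⟩)

/-- With the conjugated flow as witness, the inner `P_c⁻¹` cancels the `dP_c` carried by the field.
What remains is `a dP_c` applied to the original curve at parameter `c ε`, whence the factor `a c`.
-/
theorem HasDot.dilate {S : SubRiemannianStructure n M} {c : ℝ} (hc : 0 < c) (a : ℝ)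
    {lam : ℝ → CotangentBundle n M} {V : ∀ t : ℝ, TangentSpace (cotI n) (lam t)} {t : ℝ}
    {W : TangentSpace (cotI n) (lam (c * t))} (hlam : ContinuousAt lam (c * t))
    (h : S.HasDot lam V (c * t) W) :
    S.HasDot (fun t => dilation c (lam (c * t)))
      (fun t => (a • modelDilation n c (V (c * t)) : CotModel n)) t
      ((a * c) • modelDilation n c W : CotModel n) := by
  obtain ⟨δ, U, Φ, hΦ, hU, hder⟩ := h
  refine ⟨δ / c, _, _, hΦ.dilate hc, ?_, ?_⟩
  · change dilation c⁻¹ (dilation c (lam (c * t))) ∈ U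
    rwa [dilation_inv_dilation hc.ne']
  have hm : HasDerivAt (fun ε : ℝ => c * ε) c 0 := by
    simpa using (hasDerivAt_id (0 : ℝ)).const_mul c
  have hder' : HasDerivAt (F := CotModel n)
      (fun ε : ℝ => (mfderiv (cotI n) (cotI n) (Φ (-ε)) (lam (c * t + ε)) (V (c * t + ε)) :
        CotModel n)) W (c * 0) := by rwa [mul_zero]
  have h1 := ((modelDilation n c).hasFDerivAt.comp_hasDerivAt (0 : ℝ)
    (hder'.scomp (0 : ℝ) hm)).const_smul a
  have h2 : ∀ w : CotModel n, a • modelDilation n c (c • w) = (a * c) • modelDilation n c w := by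
    intro w
    rw [ContinuousLinearMap.map_smul, smul_smul]
  refine (h1.congr_deriv (h2 W)).congr_of_eventuallyEq ?_
  -- Continuity of the extremal keeps nearby points in `U`, where the flow maps are differentiable
  -- and the chain rule applies.
  have e1 : ∀ᶠ ε : ℝ in 𝓝 0, lam (c * t + c * ε) ∈ U := by
    have hcont : ContinuousAt (fun ε : ℝ => lam (c * t + c * ε)) 0 := by
      refine ContinuousAt.comp (g := lam) (by simpa using hlam) (by fun_prop)
    refine hcont.eventually_mem (hΦ.isOpen.mem_nhds ?_)
    simpa using hU
  have e2 : ∀ᶠ ε : ℝ in 𝓝 0, -(c * ε) ∈ Ioo (-δ) δ := by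
    have hcont : ContinuousAt (fun ε : ℝ => -(c * ε)) 0 := by fun_prop
    refine hcont.eventually_mem (isOpen_Ioo.mem_nhds ?_)
    simpa using hΦ.pos
  filter_upwards [e1, e2] with ε hε1 hε2
  have hdiff : ∀ q ∈ U, MDifferentiableAt (cotI n) (cotI n) (Φ (-(c * ε))) q := by
    intro q hq
    have hs : ContMDiffAt (𝓘(ℝ, ℝ).prod (cotI n)) (cotI n) ∞
        (fun z : ℝ × CotangentBundle n M => Φ z.1 z.2) (-(c * ε), q) :=
      (hΦ.smooth _ ⟨hε2, hq⟩).contMDiffAt ((isOpen_Ioo.prod hΦ.isOpen).mem_nhds ⟨hε2, hq⟩)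
    have hp : ContMDiffAt (cotI n) (𝓘(ℝ, ℝ).prod (cotI n)) ∞
        (fun q : CotangentBundle n M => (-(c * ε), q)) q :=
      contMDiffAt_const.prodMk contMDiffAt_id
    exact (hs.comp q hp).mdifferentiableAt (by simp)
  have key : ∀ q r : CotangentBundle n M, r = dilation c q → q ∈ U → ∀ w : CotModel n,
      (mfderiv (cotI n) (cotI n)
        (fun q => dilation c (Φ (c * -ε) (dilation c⁻¹ q))) r
        (a • modelDilation n c w : CotModel n) : CotModel n) =
      a • modelDilation n c (mfderiv (cotI n) (cotI n) (Φ (-(c * ε))) q w : CotModel n) := by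
    rintro q _ rfl hq w
    have hq' : dilation c⁻¹ (dilation c q) = q := dilation_inv_dilation hc.ne' q
    have hd : MDifferentiableAt (cotI n) (cotI n) (Φ (-(c * ε)))
        (dilation c⁻¹ (dilation c q)) := by rw [hq']; exact hdiff q hq
    have hcomp := ((hasMFDerivAt_dilation c _).comp _ (hd.hasMFDerivAt.comp _
      (hasMFDerivAt_dilation c⁻¹ (dilation c q)))).mfderiv
    have hcongr : ∀ r r' : CotangentBundle n M, r = r' → ∀ w w' : CotModel n, w = w' →
        (mfderiv (cotI n) (cotI n) (Φ (-(c * ε))) r w : CotModel n) =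
          mfderiv (cotI n) (cotI n) (Φ (-(c * ε))) r' w' := by
      rintro r _ rfl w _ rfl; rfl
    rw [mul_neg]
    refine (DFunLike.congr_fun hcomp (a • modelDilation n c w : CotModel n)).trans ?_
    change modelDilation n c (mfderiv (cotI n) (cotI n) (Φ (-(c * ε)))
      (dilation c⁻¹ (dilation c q))
        (modelDilation n c⁻¹ (a • modelDilation n c w)) : CotModel n) = _
    have hw : modelDilation n c⁻¹ (a • modelDilation n c w) = a • w := by
      rw [ContinuousLinearMap.map_smul]; congr 1
      exact (modelDilationEquiv n hc.ne').symm_apply_apply w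
    exact (congrArg (modelDilation n c) ((hcongr _ _ hq' _ _ hw).trans
      ((mfderiv (cotI n) (cotI n) (Φ (-(c * ε))) q).map_smul a w))).trans
      ((modelDilation n c).map_smul a _)
  have hV : ∀ s s' : ℝ, s = s' → lam s ∈ U →
      (mfderiv (cotI n) (cotI n)
        (fun q => dilation c (Φ (c * -ε) (dilation c⁻¹ q))) (dilation c (lam s))
        (a • modelDilation n c (V s) : CotModel n) : CotModel n) =
      a • modelDilation n c (mfderiv (cotI n) (cotI n) (Φ (-(c * ε))) (lam s') (V s') :
        CotModel n) := by
    rintro s _ rfl hs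
    exact key _ _ rfl hs _
  refine hV _ _ (mul_add c t ε) ?_
  rwa [mul_add]

/-! ### The geodesic flag under a linear change of time -/

theorem contMDiff_iterate_mlieBracket (T X : ∀ x : M, TangentSpace (𝓡 n) x)
    (hT : ContMDiff (𝓡 n) (𝓡 n).tangent ∞ (fun x => (⟨x, T x⟩ : TangentBundle (𝓡 n) M)))
    (hX : ContMDiff (𝓡 n) (𝓡 n).tangent ∞ (fun x => (⟨x, X x⟩ : TangentBundle (𝓡 n) M)))
    (j : ℕ) :
    ContMDiff (𝓡 n) (𝓡 n).tangent ∞ (fun x =>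
      (⟨x, ((fun Y => VectorField.mlieBracket (𝓡 n) T Y)^[j] X) x⟩ : TangentBundle (𝓡 n) M)) := by
  induction j with
  | zero => exact hX
  | succ j ih =>
    rw [Function.iterate_succ_apply']
    have : IsManifold (𝓡 n) (minSmoothness ℝ 2) M := by
      rw [minSmoothness_of_isRCLikeNormedField]
      infer_instance
    have : IsManifold (𝓡 n) ((⊤ : ℕ∞) + 1) M := inferInstanceAs (IsManifold (𝓡 n) ∞ M)
    exact ContDiff.mlieBracket_vectorField (m := ⊤) (n := ⊤) hT ih
      (by rw [minSmoothness_of_isRCLikeNormedField]; rfl)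

/-- Each bracket with `c T` contributes one factor `c`; smoothness of the iterates lets the constant
pass through the next bracket. -/
theorem iterate_mlieBracket_const_smul (c : ℝ) (T X : ∀ x : M, TangentSpace (𝓡 n) x)
    (hT : ContMDiff (𝓡 n) (𝓡 n).tangent ∞ (fun x => (⟨x, T x⟩ : TangentBundle (𝓡 n) M)))
    (hX : ContMDiff (𝓡 n) (𝓡 n).tangent ∞ (fun x => (⟨x, X x⟩ : TangentBundle (𝓡 n) M)))
    (j : ℕ) :
    (fun Y => VectorField.mlieBracket (𝓡 n) (c • T) Y)^[j] X =
      c ^ j • ((fun Y => VectorField.mlieBracket (𝓡 n) T Y)^[j] X) := by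
  induction j with
  | zero => simp
  | succ j ih =>
    rw [Function.iterate_succ_apply', Function.iterate_succ_apply', ih]
    funext x
    rw [VectorField.mlieBracket_const_smul_left ((hT x).mdifferentiableAt (by simp)),
      VectorField.mlieBracket_const_smul_right
      ((contMDiff_iterate_mlieBracket T X hT hX j x).mdifferentiableAt (by simp)),
      smul_smul, pow_succ']
    rfl

theorem IsSectionOf.const_smul (c : ℝ) {D : ∀ x : M, Submodule ℝ (TangentSpace (𝓡 n) x)}
    {T : ∀ x : M, TangentSpace (𝓡 n) x} (hT : IsSectionOf D T) : IsSectionOf D (c • T) :=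
  ⟨hT.1.const_smul_section, fun x => (D x).smul_mem c (hT.2 x)⟩

theorem flag_le_flag_comp_mul {c : ℝ} (hc : c ≠ 0) (γ : ℝ → M) (t : ℝ) (i : ℕ)
    (hγ : ∀ᶠ s in 𝓝 (c * t), MDifferentiableAt 𝓘(ℝ, ℝ) (𝓡 n) γ s) :
    S.flag γ (c * t) i ≤ S.flag (fun s => γ (c * s)) t i := by
  refine Submodule.span_le.2 ?_
  rintro v ⟨T, X, hT, hX, hTγ, j, hj, rfl⟩
  have hcont : Tendsto (fun s : ℝ => c * s) (𝓝 t) (𝓝 (c * t)) :=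
    (continuous_const.mul continuous_id).continuousAt
  have hmem : ((fun Y => VectorField.mlieBracket (𝓡 n) (c • T) Y)^[j] X) (γ (c * t)) ∈
      S.flag (fun s => γ (c * s)) t i := by
    -- By the chain rule, `c T` extends the velocity of `γ(c ·)` near `t`.
    refine Submodule.subset_span ⟨c • T, X, IsSectionOf.const_smul c hT, hX, ?_, j, hj, rfl⟩
    filter_upwards [hcont.eventually hTγ, hcont.eventually hγ] with s hs hd
    have hm : HasMFDerivAt 𝓘(ℝ, ℝ) 𝓘(ℝ, ℝ) (fun t : ℝ => c * t) s
        (c • ContinuousLinearMap.id ℝ ℝ) :=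
      ((hasFDerivAt_id (𝕜 := ℝ) s).const_smul c).hasMFDerivAt
    have h1 := (hd.hasMFDerivAt.comp s hm).mfderiv
    refine Eq.trans ?_ (DFunLike.congr_fun h1 (1 : ℝ)).symm
    change c • T (γ (c * s)) = mfderiv 𝓘(ℝ, ℝ) (𝓡 n) γ (c * s) (c • (1 : ℝ))
    rw [hs]
    exact (ContinuousLinearMap.map_smul (mfderiv 𝓘(ℝ, ℝ) (𝓡 n) γ (c * s)) c (1 : ℝ)).symm
  rw [iterate_mlieBracket_const_smul c T X hT.1 hX.1] at hmem
  exact ((S.flag (fun s => γ (c * s)) t i).smul_mem_iff (pow_ne_zero j hc)).1 hmem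

theorem flag_comp_mul {c : ℝ} (hc : c ≠ 0) (γ : ℝ → M) (t : ℝ) (i : ℕ)
    (hγ : ∀ᶠ s in 𝓝 (c * t), MDifferentiableAt 𝓘(ℝ, ℝ) (𝓡 n) γ s) :
    S.flag (fun s => γ (c * s)) t i = S.flag γ (c * t) i := by
  refine le_antisymm ?_ (S.flag_le_flag_comp_mul hc γ t i hγ)
  -- The reverse inclusion is the previous lemma for the factor `c⁻¹` and the curve `γ(c ·)`.
  have ht : c⁻¹ * (c * t) = t := inv_mul_cancel_left₀ hc t
  have hγ' : (fun s => (fun s => γ (c * s)) (c⁻¹ * s)) = γ := by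
    funext s; simp [mul_inv_cancel_left₀ hc]
  have hd : ∀ᶠ s in 𝓝 (c⁻¹ * (c * t)),
      MDifferentiableAt 𝓘(ℝ, ℝ) (𝓡 n) (fun s => γ (c * s)) s := by
    rw [ht]
    have hcont : Tendsto (fun s : ℝ => c * s) (𝓝 t) (𝓝 (c * t)) :=
      (continuous_const.mul continuous_id).continuousAt
    filter_upwards [hcont.eventually hγ] with s hs
    have hm : MDifferentiableAt 𝓘(ℝ, ℝ) 𝓘(ℝ, ℝ) (fun t : ℝ => c * t) s :=
      (differentiableAt_id.const_mul c).mdifferentiableAt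
    exact hs.comp s hm
  have h := S.flag_le_flag_comp_mul (inv_ne_zero hc) (fun s => γ (c * s)) (c * t) i hd
  have key : ∀ (γ' : ℝ → M) (t' : ℝ), γ' = γ → t' = t →
      (S.flag (fun s => γ (c * s)) t' i : Submodule ℝ (Model n)) ≤ S.flag γ' (c * t) i →
      (S.flag (fun s => γ (c * s)) t i : Submodule ℝ (Model n)) ≤ S.flag γ (c * t) i := by
    rintro _ _ rfl rfl h; exact h
  exact key _ _ hγ' ht h

end SubRiemannianStructure

/-! ### Weighted frames, normal matrices and smooth vector fields along curves -/

theorem linearIndependent_and_span_smul_map {ι V : Type*} [AddCommGroup V] [Module ℝ V]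
    (L : V ≃ₗ[ℝ] V) (w : ι → ℝ) (hw : ∀ i, w i ≠ 0) (f : ι → V) (hf : LinearIndependent ℝ f)
    (hs : Submodule.span ℝ (range f) = ⊤) :
    LinearIndependent ℝ (fun i => w i • L (f i)) ∧
      Submodule.span ℝ (range fun i => w i • L (f i)) = ⊤ := by
  let b := ((Module.Basis.mk hf hs.ge).map L).unitsSMul (fun i => Units.mk0 (w i) (hw i))
  have hb : ⇑b = fun i => w i • L (f i) := by
    funext i
    simp [b, Module.Basis.unitsSMul_apply, Units.smul_def]
  rw [← hb]
  exact ⟨b.linearIndependent, b.span_eq⟩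

theorem IsNormal.dilate {y : YoungDiagram} {R : Matrix (Box y) (Box y) ℝ} (h : IsNormal R)
    (c : ℝ) : IsNormal (fun p q => c ^ (p.col + q.col) * R p q : Matrix (Box y) (Box y) ℝ) where
  symm p q := by rw [h.symm p q, add_comm]
  -- Both entries carry the exponent `2i + 1`, so the relation is merely multiplied by a constant.
  skew p q p' q' hl hc hp hq hp' hq' := by
    rw [h.skew p q p' q' hl hc hp hq hp' hq', hp', hq', hc, mul_neg]
  vanish_eq p q hl hR := h.vanish_eq p q hl (right_ne_zero_of_mul hR)
  vanish_gt p q hl hR := h.vanish_gt p q hl (right_ne_zero_of_mul hR)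

/-- Local trivializations are linear on fibers, so the scalar passes to the fiber coordinate. -/
theorem contMDiffOn_const_smul_totalSpace {B F : Type*} {Z : B → Type*} {EB HB : Type*}
    [NormedAddCommGroup F] [NormedSpace ℝ F] [TopologicalSpace (TotalSpace F Z)]
    [∀ x, TopologicalSpace (Z x)] [∀ x, AddCommGroup (Z x)] [∀ x, Module ℝ (Z x)]
    [NormedAddCommGroup EB] [NormedSpace ℝ EB] [TopologicalSpace HB]
    {IB : ModelWithCorners ℝ EB HB} [TopologicalSpace B] [ChartedSpace HB B]
    [FiberBundle F Z] [VectorBundle ℝ F Z] {J : Set ℝ} {f : ℝ → B} {V : ∀ t, Z (f t)}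
    (h : ContMDiffOn 𝓘(ℝ, ℝ) (IB.prod 𝓘(ℝ, F)) ∞ (fun t => (⟨f t, V t⟩ : TotalSpace F Z)) J)
    (a : ℝ) :
    ContMDiffOn 𝓘(ℝ, ℝ) (IB.prod 𝓘(ℝ, F)) ∞
      (fun t => (⟨f t, a • V t⟩ : TotalSpace F Z)) J := by
  intro t ht
  obtain ⟨h1, h2⟩ := Bundle.contMDiffWithinAt_totalSpace.1 (h t ht)
  rw [Bundle.contMDiffWithinAt_totalSpace]
  refine ⟨h1, ?_⟩
  have h3 : ContMDiffWithinAt 𝓘(ℝ, ℝ) 𝓘(ℝ, F) ∞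
      (fun s => a • (trivializationAt F Z (f t) ⟨f s, V s⟩).2) J t :=
    (contMDiffWithinAt_const (I' := 𝓘(ℝ, ℝ)) (c := a)).smul h2
  have hlin : ∀ s, f s ∈ (trivializationAt F Z (f t)).baseSet →
      (trivializationAt F Z (f t) ⟨f s, a • V s⟩).2 =
        a • (trivializationAt F Z (f t) ⟨f s, V s⟩).2 := fun s hs =>
    ((trivializationAt F Z (f t)).linear ℝ hs).map_smul a (V s)
  refine h3.congr_of_eventuallyEq ?_ (hlin t (FiberBundle.mem_baseSet_trivializationAt' (f t)))
  filter_upwards [h1.continuousWithinAt.eventually_mem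
    ((trivializationAt F Z (f t)).open_baseSet.mem_nhds
      (FiberBundle.mem_baseSet_trivializationAt' (f t)))] with s hs
  exact hlin s hs

variable {n : ℕ} {M : Type*} [TopologicalSpace M] [ChartedSpace (Model n) M]
  [IsManifold (𝓡 n) ∞ M]

theorem contMDiffOn_dilation_vectorField (c a : ℝ) {lam : ℝ → CotangentBundle n M} {J : Set ℝ}
    {V : ∀ t, TangentSpace (cotI n) (lam t)}
    (h : ContMDiffOn 𝓘(ℝ, ℝ) (cotI n).tangent ∞
      (fun t => (⟨lam t, V t⟩ : TangentBundle (cotI n) (CotangentBundle n M))) J) :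
    ContMDiffOn 𝓘(ℝ, ℝ) (cotI n).tangent ∞
      (fun t => (⟨dilation c (lam (c * t)), (a • modelDilation n c (V (c * t)) : CotModel n)⟩ :
        TangentBundle (cotI n) (CotangentBundle n M))) {t | c * t ∈ J} := by
  have hm : ContMDiff 𝓘(ℝ, ℝ) 𝓘(ℝ, ℝ) ∞ (fun t : ℝ => c * t) :=
    (contDiff_const.mul contDiff_id).contMDiff
  have h1 := h.comp (s := {t | c * t ∈ J}) hm.contMDiffOn (fun t ht => ht)
  have h2 : ContMDiff (cotI n).tangent (cotI n).tangent ∞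
      (tangentMap (cotI n) (cotI n) (dilation c : CotangentBundle n M → CotangentBundle n M)) :=
    (contMDiff_dilation c).contMDiff_tangentMap (by rfl)
  have h3 := contMDiffOn_const_smul_totalSpace (h2.comp_contMDiffOn h1) a
  refine h3.congr fun t _ => ?_
  exact (congrArg (fun v : CotModel n => (⟨dilation c (lam (c * t)), a • v⟩ :
    TangentBundle (cotI n) (CotangentBundle n M)))
      (DFunLike.congr_fun (mfderiv_dilation c (lam (c * t))) (V (c * t)))).symm

/-! ### Assembly of the rescaled canonical frame -/

namespace SubRiemannianStructure

variable {S : SubRiemannianStructure n M}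

theorem IsExtremalOn.mdifferentiableAt_proj {lam : ℝ → CotangentBundle n M} {J : Set ℝ}
    (h : S.IsExtremalOn lam J) {t : ℝ} (ht : t ∈ J) :
    MDifferentiableAt 𝓘(ℝ, ℝ) (𝓡 n) (fun t => (lam t).proj) t := by
  obtain ⟨v, hv, -⟩ := h t ht
  exact ((Bundle.contMDiff_proj (n := ∞) (fun x : M => TangentSpace (𝓡 n) x →L[ℝ] ℝ)
    (lam t)).mdifferentiableAt (by simp)).comp t hv.mdifferentiableAt

theorem IsExtremalOn.flag_dilation {lam : ℝ → CotangentBundle n M} {J : Set ℝ} (hJ : IsOpen J)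
    (h : S.IsExtremalOn lam J) {c : ℝ} (hc : c ≠ 0) {t : ℝ} (ht : c * t ∈ J) (i : ℕ) :
    S.flag (fun t => (dilation c (lam (c * t))).proj) t i =
      S.flag (fun t => (lam t).proj) (c * t) i :=
  S.flag_comp_mul hc (fun t => (lam t).proj) t i <| by
    filter_upwards [hJ.mem_nhds ht] with s hs
    exact h.mdifferentiableAt_proj hs

theorem HasDot.congr {lam : ℝ → CotangentBundle n M} {V : ∀ t, TangentSpace (cotI n) (lam t)}
    {t : ℝ} {W W' : TangentSpace (cotI n) (lam t)} (h : S.HasDot lam V t W) (hW : W = W') :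
    S.HasDot lam V t W' := hW ▸ h

end SubRiemannianStructure

theorem IsCanonicalFrame.congr {S : SubRiemannianStructure n M} {q₀ : CotangentBundle n M}
    {J : Set ℝ} {lam : ℝ → CotangentBundle n M} {y : YoungDiagram}
    {E F E' F' : Box y → ∀ t : ℝ, TangentSpace (cotI n) (lam t)}
    {R : ℝ → Matrix (Box y) (Box y) ℝ} (h : IsCanonicalFrame S q₀ J lam y E F R)
    (hE : ∀ p, E p = E' p) (hF : ∀ p, F p = F' p) :
    IsCanonicalFrame S q₀ J lam y E' F' R := by
  obtain rfl := funext hE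
  obtain rfl := funext hF
  exact h

theorem IsCanonicalFrame.dilate {S : SubRiemannianStructure n M} {q₀ : CotangentBundle n M}
    {J : Set ℝ} {lam : ℝ → CotangentBundle n M} {y : YoungDiagram}
    {E F : Box y → ∀ t : ℝ, TangentSpace (cotI n) (lam t)}
    {R : ℝ → Matrix (Box y) (Box y) ℝ} (h : IsCanonicalFrame S q₀ J lam y E F R)
    {c : ℝ} (hc : 0 < c) :
    IsCanonicalFrame S (dilation c q₀) {t : ℝ | c * t ∈ J}
      (fun t => dilation c (lam (c * t))) y
      (fun p t => (c ^ (-(p.col : ℤ)) • modelDilation n c (E p (c * t)) : CotModel n))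
      (fun p t => (c ^ ((p.col : ℤ) - 1) • modelDilation n c (F p (c * t)) : CotModel n))
      (fun t p q => c ^ (p.col + q.col) * R (c * t) p q) := by
  have hc0 := hc.ne'
  have hcont : ∀ t, c * t ∈ J → ContinuousAt lam (c * t) := fun t ht => by
    obtain ⟨v, hv, -⟩ := h.extremal _ ht
    exact hv.continuousAt
  have hmul : Continuous fun t : ℝ => c * t := continuous_const.mul continuous_id
  have hsympl : ∀ (t a b : ℝ) (ξ η : CotModel n),
      sympl (dilation c (lam (c * t))) (a • modelDilation n c ξ : CotModel n)
        (b • modelDilation n c η : CotModel n) = a * b * c * sympl (lam (c * t)) ξ η := by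
    intro t a b ξ η
    refine (sympl_smul_left a _ _ _).trans ?_
    refine (congrArg (a * ·) ((sympl_smul_right b _ _ _).trans
      (congrArg (b * ·) (sympl_dilation hc0 (lam (c * t)) ξ η)))).trans ?_
    ring
  have hframe : ∀ t, c * t ∈ J → _ := fun t ht => linearIndependent_and_span_smul_map
    (modelDilationEquiv n hc0).toLinearEquiv
    (Sum.elim (fun p : Box y => c ^ (-(p.col : ℤ))) (fun p : Box y => c ^ ((p.col : ℤ) - 1)))
    (by rintro (p | p) <;> exact zpow_ne_zero _ hc0)
    (Sum.elim (fun p => (E p (c * t) : CotModel n)) (fun p => F p (c * t)))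
    (h.linearIndependent _ ht) (h.span_eq_top _ ht)
  have hfun : ∀ t, (fun i : Box y ⊕ Box y => (Sum.elim (fun p : Box y => c ^ (-(p.col : ℤ)))
      (fun p : Box y => c ^ ((p.col : ℤ) - 1)) i) • (modelDilationEquiv n hc0).toLinearEquiv
      (Sum.elim (fun p => (E p (c * t) : CotModel n)) (fun p => F p (c * t)) i)) =
      Sum.elim (fun p => (c ^ (-(p.col : ℤ)) • modelDilation n c (E p (c * t)) : CotModel n))
        (fun p => (c ^ ((p.col : ℤ) - 1) • modelDilation n c (F p (c * t)) : CotModel n)) := by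
    intro t
    funext i
    rcases i with p | p <;> rfl
  -- Inserting `c^j c^{-j}` rewrites the sum in terms of the rescaled `E_{bj}`.
  have hsum : ∀ (a : ℝ) (r : Box y → ℝ) (e : Box y → CotModel n),
      a • modelDilation n c (∑ q, r q • e q) =
        ∑ q, (a * c ^ (q.col : ℤ) * r q) • c ^ (-(q.col : ℤ)) • modelDilation n c (e q) := by
    intro a r e
    rw [map_sum, Finset.smul_sum]
    refine Finset.sum_congr rfl fun q _ => ?_
    rw [(modelDilation n c).map_smul, smul_smul, smul_smul, zpow_neg]
    congr 1
    have := zpow_ne_zero (q.col : ℤ) hc0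
    field_simp
  have hsumR : ∀ (p : Box y) (t : ℝ) (e : Box y → CotModel n),
      (c ^ ((p.col : ℤ) - 1) * c) • modelDilation n c (∑ q, R (c * t) p q • e q) =
        ∑ q, (c ^ (p.col + q.col) * R (c * t) p q) •
          c ^ (-(q.col : ℤ)) • modelDilation n c (e q) := by
    intro p t e
    rw [hsum]
    refine Finset.sum_congr rfl fun q _ => ?_
    -- The weight `c^{i-1}` times the factor `c` from the dot derivative is `c^i`; with `c^j` this
    -- is the exponent `i + j`.
    rw [← zpow_add_one₀ hc0, sub_add_cancel, pow_add, zpow_natCast, zpow_natCast]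
  have hflag := fun (t : ℝ) (ht : c * t ∈ J) (i : ℕ) =>
    h.extremal.flag_dilation h.isOpen hc0 ht i
  exact
  { isOpen := h.isOpen.preimage hmul
    ordConnected := by
      refine ⟨fun s hs t ht r hr => ?_⟩
      exact h.ordConnected.out hs ht ⟨mul_le_mul_of_nonneg_left hr.1 hc.le,
        mul_le_mul_of_nonneg_left hr.2 hc.le⟩
    zero_mem := by
      change c * 0 ∈ J
      rw [mul_zero]; exact h.zero_mem
    initial := by rw [mul_zero, h.initial]
    extremal := h.extremal.dilate hc0
    ample := by
      intro t ht
      obtain ⟨m, hm, hr⟩ := h.ample _ ht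
      refine ⟨m, hm, ?_⟩
      rw [hflag t ht m]; exact hr
    equiregular := by
      intro i hi s hs t ht
      rw [hflag s hs i, hflag t ht i]
      exact h.equiregular i hi _ hs _ ht
    young := by
      intro t ht i
      rw [hflag t ht i, hflag t ht (i + 1)]
      exact h.young _ ht i
    smooth_E := fun p => contMDiffOn_dilation_vectorField c _ (h.smooth_E p)
    smooth_F := fun p => contMDiffOn_dilation_vectorField c _ (h.smooth_F p)
    linearIndependent := by
      intro t ht
      have h1 := (hframe t ht).1
      rw [hfun] at h1
      exact h1
    span_eq_top := by
      intro t ht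
      have h1 := (hframe t ht).2
      rw [hfun] at h1
      exact h1
    vertical := by
      intro p t ht
      refine ((dproj (dilation c (lam (c * t)))).map_smul _ _).trans ?_
      refine (congrArg (fun v : Model n => c ^ (-(p.col : ℤ)) • v)
        ((dproj_dilation c (lam (c * t)) (E p (c * t))).trans (h.vertical p _ ht))).trans ?_
      exact smul_zero (A := Model n) _
    darboux_EE := by
      intro p q t ht
      refine (hsympl t _ _ _ _).trans ?_
      rw [h.darboux_EE p q _ ht, mul_zero]
    darboux_FF := by
      intro p q t ht
      refine (hsympl t _ _ _ _).trans ?_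
      rw [h.darboux_FF p q _ ht, mul_zero]
    darboux_EF := by
      intro p q t ht
      refine (hsympl t _ _ _ _).trans ?_
      rw [h.darboux_EF p q _ ht]
      split_ifs with hpq
      · subst hpq
        -- The product `c^{-i} c^{i-1} c` equals `1`.
        rw [mul_one, mul_assoc, ← zpow_add_one₀ hc0, ← zpow_add₀ hc0]
        simp
      · exact mul_zero _
    dot_E := by
      intro p p' hrow hcol t ht
      refine ((h.dot_E p p' hrow hcol _ ht).dilate hc (c ^ (-(p.col : ℤ))) (hcont t ht)).congr ?_
      have : c ^ (-(p.col : ℤ)) * c = c ^ (-(p'.col : ℤ)) := by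
        rw [← zpow_add_one₀ hc0, hcol]
        congr 1
      rw [this]
    dot_E_one := by
      intro p hcol t ht
      refine ((h.dot_E_one p hcol _ ht).dilate hc (c ^ (-(p.col : ℤ))) (hcont t ht)).congr ?_
      -- Only for `i = 1`: both sides are `c^0`.
      have : c ^ (-(p.col : ℤ)) * c = c ^ ((p.col : ℤ) - 1) := by
        rw [← zpow_add_one₀ hc0, hcol]
        simp
      rw [this]
      have hneg : ∀ (a : ℝ) (v : CotModel n),
          a • modelDilation n c (-v) = -(a • modelDilation n c v) := by
        intro a v
        rw [map_neg, smul_neg]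
      exact hneg _ _
    dot_F := by
      intro p p' hrow hcol t ht
      refine ((h.dot_F p p' hrow hcol _ ht).dilate hc (c ^ ((p.col : ℤ) - 1))
        (hcont t ht)).congr ?_
      have hsub : ∀ (a : ℝ) (v w : CotModel n), a • modelDilation n c (v - w) =
          a • modelDilation n c v - a • modelDilation n c w := by
        intro a v w
        rw [map_sub, smul_sub]
      refine (hsub _ _ _).trans (congrArg₂ (fun v w : CotModel n => v - w) (hsumR p t _) ?_)
      have : c ^ ((p.col : ℤ) - 1) * c = c ^ ((p'.col : ℤ) - 1) := by
        rw [← zpow_add_one₀ hc0, hcol]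
        simp
      rw [this]
    dot_F_last := by
      intro p hcol t ht
      exact ((h.dot_F_last p hcol _ ht).dilate hc (c ^ ((p.col : ℤ) - 1))
        (hcont t ht)).congr (hsumR p t _)
    smooth_R := by
      intro p q
      refine contDiffOn_const.mul ((h.smooth_R p q).comp (contDiff_const.mul contDiff_id).contDiffOn
        fun t ht => ht)
    normal := fun t ht => (h.normal _ ht).dilate c }

end SubRiem

end

theorem propositionp {n : ℕ} {M : Type*} [TopologicalSpace M] [T2Space M]
    [SecondCountableTopology M] [ChartedSpace (SubRiem.Model n) M] [IsManifold (𝓡 n) ∞ M]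
    (S : SubRiem.SubRiemannianStructure n M)
    (q₀ : SubRiem.CotangentBundle n M) (hq₀ : q₀ ∈ S.levelSet 1)
    (J : Set ℝ) (lam : ℝ → SubRiem.CotangentBundle n M) (y : YoungDiagram)
    (E F : SubRiem.Box y → ∀ t : ℝ, TangentSpace (SubRiem.cotI n) (lam t))
    (R : ℝ → Matrix (SubRiem.Box y) (SubRiem.Box y) ℝ)
    (hcan : SubRiem.IsCanonicalFrame S q₀ J lam y E F R)
    (c : ℝ) (hc : 0 < c) :
    SubRiem.dilation c q₀ ∈ S.levelSet (c ^ 2) ∧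
    SubRiem.IsCanonicalFrame S (SubRiem.dilation c q₀) {t : ℝ | c * t ∈ J}
      (fun t => SubRiem.dilation c (lam (c * t))) y
      (fun p t => c ^ (-(p.col : ℤ)) •
        mfderiv (SubRiem.cotI n) (SubRiem.cotI n) (SubRiem.dilation c) (lam (c * t)) (E p (c * t)))
      (fun p t => c ^ ((p.col : ℤ) - 1) •
        mfderiv (SubRiem.cotI n) (SubRiem.cotI n) (SubRiem.dilation c) (lam (c * t)) (F p (c * t)))
      (fun t p q => c ^ (p.col + q.col) * R (c * t) p q) := by
  constructor
  · change S.hamiltonian (SubRiem.dilation c q₀) = c ^ 2 / 2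
    rw [S.hamiltonian_dilation, show S.hamiltonian q₀ = 1 / 2 from hq₀]
    ring
  -- Replaces the coordinate form of `dP_c` by the differential itself.
  · have hd : ∀ (a : ℝ) (q : SubRiem.CotangentBundle n M) (v : SubRiem.CotModel n),
        (a • SubRiem.modelDilation n c v : SubRiem.CotModel n) =
          a • mfderiv (SubRiem.cotI n) (SubRiem.cotI n) (SubRiem.dilation c) q v := fun a q v =>
      congrArg (a • ·) (DFunLike.congr_fun (SubRiem.mfderiv_dilation c q) v).symm
    exact (hcan.dilate hc).congr (fun p => funext fun t => hd _ _ _)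
      (fun p => funext fun t => hd _ _ _)
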